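/- Let $M$ be a finite matroid without loops, of rank $d\ge 1$, on a ground set $E$ with $m$ elements. For $0\le i\le d-1$ let $N_i$ be the dual of the $i$-th truncation of $M$, where the $i$-th truncation is the matroid on $E$ whose independent sets are the independent sets of $M$ with at most $d-i$ elements. For a matroid $N$ let $\mathcal J(N)$ be the simplicial complex of independent sets of $N$, and let $\widetilde H_j(\mathcal J(N);\mathbb Z)$ be its reduced simplicial homology (the empty set being a face of dimension $-1$). Let $$\chi_M(t)=\sum_{F}\mu(\hat 0,F)\,t^{\,d-\rho(F)}$$ be the characteristic polynomial of $M$, the sum being over all flats $F$ of $M$, where $\rho$ is the rank function of $M$, $\mu$ is the Möbius function of the lattice of flats of $M$ and $\hat 0$ is its least element. Then $$\chi_M(t)=(-1)^d(1-t)\sum_{i=0}^{d-1}\operatorname{rank}\widetilde H_{m-d+i-1}(\mathcal J(N_i);\mathbb Z)\,(-t)^i .$$ -/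

import Mathlib

noncomputable section

namespace PreAbstractSimplicialComplex

variable {V : Type*} [LinearOrder V]

/-- The simplicial boundary on integral chains. A finite vertex set stands for the simplex oriented
by listing its vertices in increasing order, so
`∂ [v₀ < ⋯ < vₖ] = ∑ i, (-1) ^ i [v₀, …, v̂ᵢ, …, vₖ]`; the boundary of a vertex is the empty simplex,
and the boundary of the empty simplex is zero. -/
def boundary : (Finset V →₀ ℤ) →ₗ[ℤ] (Finset V →₀ ℤ) :=
  Finsupp.linearCombination ℤ fun s ↦
    ∑ v ∈ s, Finsupp.single (s.erase v) ((-1 : ℤ) ^ (s.filter (· < v)).card)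

/-- The augmented simplicial chains of dimension `j`: integral combinations of the faces with
`j + 1` vertices. The empty set is counted as the face of dimension `-1`; it is left implicit in a
`PreAbstractSimplicialComplex`. -/
def chains (K : PreAbstractSimplicialComplex V) (j : ℤ) : Submodule ℤ (Finset V →₀ ℤ) :=
  Finsupp.supported ℤ ℤ {s | (s = ∅ ∨ s ∈ K) ∧ (s.card : ℤ) = j + 1}

/-- The reduced cycles of dimension `j`. -/
def cycles (K : PreAbstractSimplicialComplex V) (j : ℤ) : Submodule ℤ (Finset V →₀ ℤ) :=
  K.chains j ⊓ LinearMap.ker boundary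

/-- The boundaries of dimension `j`. -/
def boundaries (K : PreAbstractSimplicialComplex V) (j : ℤ) : Submodule ℤ (Finset V →₀ ℤ) :=
  (K.chains (j + 1)).map boundary

theorem boundary_single (s : Finset V) :
    boundary (Finsupp.single s (1 : ℤ)) =
      ∑ v ∈ s, Finsupp.single (s.erase v) ((-1 : ℤ) ^ (s.filter (· < v)).card) := by
  simp [boundary]

theorem boundary_boundary (c : Finset V →₀ ℤ) : boundary (boundary c) = 0 := by
  suffices h : boundary ∘ₗ boundary = (0 : (Finset V →₀ ℤ) →ₗ[ℤ] (Finset V →₀ ℤ)) from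
    LinearMap.congr_fun h c
  ext1 s
  ext1
  have key : ∀ v ∈ s, boundary (Finsupp.single (s.erase v) ((-1 : ℤ) ^ (s.filter (· < v)).card)) =
      ∑ w ∈ s.erase v, Finsupp.single ((s.erase v).erase w)
        ((-1 : ℤ) ^ (s.filter (· < v)).card * (-1) ^ ((s.erase v).filter (· < w)).card) := by
    intro v _
    rw [← mul_one ((-1 : ℤ) ^ (s.filter (· < v)).card), ← smul_eq_mul, ← Finsupp.smul_single,
      map_smul, boundary_single, Finset.smul_sum]
    simp
  simp only [LinearMap.comp_apply, Finsupp.lsingle_apply, boundary_single, map_sum,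
    LinearMap.zero_apply]
  rw [Finset.sum_congr rfl key, Finset.sum_sigma']
  refine Finset.sum_involution (fun p _ ↦ ⟨p.2, p.1⟩) ?_ ?_ ?_ ?_
  · rintro ⟨v, w⟩ h
    simp only [Finset.mem_sigma, Finset.mem_erase] at h
    obtain ⟨hv, hwv, hw⟩ := h
    have aux : ∀ a b : V, a ∈ s → b ∈ s → a < b →
        (-1 : ℤ) ^ (s.filter (· < a)).card * (-1) ^ ((s.erase a).filter (· < b)).card +
        (-1 : ℤ) ^ (s.filter (· < b)).card * (-1) ^ ((s.erase b).filter (· < a)).card = 0 := by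
      intro a b ha hb hab
      have h1 : (s.erase b).filter (· < a) = s.filter (· < a) := by
        ext x
        simp only [Finset.mem_filter, Finset.mem_erase]
        exact ⟨fun h ↦ ⟨h.1.2, h.2⟩, fun h ↦ ⟨⟨(h.2.trans hab).ne, h.1⟩, h.2⟩⟩
      have h2 : ((s.erase a).filter (· < b)).card + 1 = (s.filter (· < b)).card := by
        rw [Finset.filter_erase]
        exact Finset.card_erase_add_one (by simp [ha, hab])
      rw [h1, ← h2, pow_succ]
      ring
    rw [Finset.erase_right_comm, ← Finsupp.single_add]
    rcases lt_or_gt_of_ne hwv with h | h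
    · rw [add_comm, aux w v hw hv h, Finsupp.single_zero]
    · rw [aux v w hv hw h, Finsupp.single_zero]
  · rintro ⟨v, w⟩ h _ heq
    simp only [Finset.mem_sigma, Finset.mem_erase] at h
    simp only [Sigma.mk.injEq] at heq
    exact h.2.1 heq.1
  · rintro ⟨v, w⟩ h
    simp only [Finset.mem_sigma, Finset.mem_erase] at h ⊢
    exact ⟨h.2.2, h.2.1.symm, h.1⟩
  · rintro ⟨v, w⟩ _
    rfl

theorem boundary_mem_chains (K : PreAbstractSimplicialComplex V) (j : ℤ) {c : Finset V →₀ ℤ}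
    (hc : c ∈ K.chains (j + 1)) : boundary c ∈ K.chains j := by
  rw [boundary, Finsupp.linearCombination_apply]
  refine Submodule.sum_mem _ fun s hs ↦ Submodule.smul_mem _ _ (Submodule.sum_mem _ fun v hv ↦ ?_)
  obtain ⟨hsK, hcard⟩ := (Finsupp.mem_supported ℤ c).1 hc hs
  refine Finsupp.single_mem_supported ℤ _ ⟨?_, ?_⟩
  · rcases (s.erase v).eq_empty_or_nonempty with h | h
    · exact Or.inl h
    · refine Or.inr ((K.isRelLowerSet_faces (hsK.resolve_left ?_)).2 (Finset.erase_subset v s) h)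
      rintro rfl
      simp at hv
  · have := Finset.card_erase_add_one hv
    omega

theorem boundaries_le_cycles (K : PreAbstractSimplicialComplex V) (j : ℤ) :
    K.boundaries j ≤ K.cycles j := by
  rintro _ ⟨c, hc, rfl⟩
  exact ⟨K.boundary_mem_chains j hc, boundary_boundary c⟩

/-- The reduced simplicial homology group of dimension `j` with integer coefficients: cycles modulo
boundaries. -/
abbrev ReducedHomology (K : PreAbstractSimplicialComplex V) (j : ℤ) : Type _ :=
  K.cycles j ⧸ (K.boundaries j).submoduleOf (K.cycles j)

end PreAbstractSimplicialComplex

namespace Matroid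

variable {α : Type*}

/-- The simplicial complex of independent sets of a matroid. -/
def independenceComplex (M : Matroid α) : PreAbstractSimplicialComplex α where
  faces := {s | s.Nonempty ∧ M.Indep (s : Set α)}
  isRelLowerSet_faces := fun _ hs ↦
    ⟨hs.1, fun _ hts ht ↦ ⟨ht, hs.2.subset (Finset.coe_subset.2 hts)⟩⟩

/-- The `i`-th truncation of a finite matroid of rank `d`: its independent sets are the independent
sets of `M` with at most `d - i` elements. -/
def truncation (M : Matroid α) [M.Finite] (i : ℕ) : Matroid α :=
  (IndepMatroid.ofFinite M.ground_finite
    (fun I ↦ M.Indep I ∧ I.encard ≤ M.eRank - (i : ℕ∞))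
    ⟨M.empty_indep, by simp⟩
    (fun _ _ hJ hIJ ↦ ⟨hJ.1.subset hIJ, (Set.encard_le_encard hIJ).trans hJ.2⟩)
    (fun I J hI hJ hlt ↦ by
      have hlt' : I.encard < J.encard := by
        rw [← (M.ground_finite.subset hI.1.subset_ground).cast_ncard_eq,
          ← (M.ground_finite.subset hJ.1.subset_ground).cast_ncard_eq]
        exact_mod_cast hlt
      obtain ⟨e, he, hins⟩ := hI.1.augment hJ.1 hlt'
      exact ⟨e, he.1, he.2, hins,
        (Set.encard_insert_le I e).trans ((Order.add_one_le_of_lt hlt').trans hJ.2)⟩)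
    (fun _ hI ↦ hI.1.subset_ground)).matroid

/-- The poset of flats of a matroid, ordered by inclusion. -/
abbrev Flat (M : Matroid α) : Type _ := {F : Set α // M.IsFlat F}

instance (M : Matroid α) [M.Finite] : Finite M.Flat :=
  (M.ground_finite.finite_subsets.subset fun _ hF ↦ IsFlat.subset_ground hF).to_subtype

instance (M : Matroid α) [M.Finite] : Fintype M.Flat := Fintype.ofFinite _

open Classical in
instance (M : Matroid α) [M.Finite] : LocallyFiniteOrder M.Flat := Fintype.toLocallyFiniteOrder

open Classical in
/-- The characteristic polynomial `∑ μ(0̂, F) t ^ (rank M - rank F)`, the sum being over the flats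
`F` of `M`, where `μ` is the Möbius function of the lattice of flats and `0̂ = closure ∅`. -/
def characteristicPolynomial (M : Matroid α) [M.Finite] : Polynomial ℤ :=
  ∑ F : M.Flat,
    Polynomial.C (IncidenceAlgebra.mu ℤ (⟨M.closure ∅, M.isFlat_closure ∅⟩ : M.Flat) F) *
      Polynomial.X ^ (M.eRank - M.eRk F.1).toNat

end Matroid

end

/-! ### Cones, and the vanishing of homology below the top dimension. -/

noncomputable section

namespace PreAbstractSimplicialComplex

variable {V : Type*} [LinearOrder V]

/-! Whitney's expansion gives χ_M(t) = ∑_{A ⊆ E} (-1)^|A| t^(d - ρ(A))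
(`characteristicPolynomial_eq_sum_powerset`). On the homological side, an independence complex has
no reduced homology below its top dimension, so the rank in the top dimension is the reduced Euler
characteristic up to sign. The independent sets of N_i are the complements of the sets A with ρ(A) ≥
d - i. Hence that rank equals ∑ (-1)^(d - i + |A|) over such A
(`finrank_reducedHomology_truncation_dual`).

After the two sums are exchanged, A contributes (-1)^|A| ∑_{d - ρ(A) ≤ i < d} t^i, up to the global
sign (-1)^d. The factor 1 - t telescopes this to (-1)^|A| (t^(d - ρ(A)) - t^d), and the terms in t^d
cancel because ∑_A (-1)^|A| = 0 for nonempty E.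

The topological input is `exists_boundary_eq_of_augmentation`: induction on the ground set through
the deletion and the link of its least element. `finrank_cycles_of_augmentation` turns this
exactness into an alternating count of faces. -/

theorem boundary_mem_supported {S T : Set (Finset V)} (h : ∀ s ∈ S, ∀ v ∈ s, s.erase v ∈ T)
    {c : Finset V →₀ ℤ} (hc : c ∈ Finsupp.supported ℤ ℤ S) :
    boundary c ∈ Finsupp.supported ℤ ℤ T := by
  rw [boundary, Finsupp.linearCombination_apply]
  exact Submodule.sum_mem _ fun s hs ↦ Submodule.smul_mem _ _ (Submodule.sum_mem _ fun v hv ↦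
    Finsupp.single_mem_supported ℤ _ (h s ((Finsupp.mem_supported ℤ c).1 hc hs) v hv))

/-- The cone with apex `e` over a chain. It carries the orientation of the join when `e` precedes
all vertices of the chain. -/
def cone (e : V) : (Finset V →₀ ℤ) →ₗ[ℤ] (Finset V →₀ ℤ) :=
  Finsupp.lmapDomain ℤ ℤ (insert e)

theorem cone_single (e : V) (s : Finset V) (n : ℤ) :
    cone e (Finsupp.single s n) = Finsupp.single (insert e s) n := by
  simp [cone]

theorem cone_mem_supported {S T : Set (Finset V)} {e : V} (h : ∀ s ∈ S, insert e s ∈ T)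
    {c : Finset V →₀ ℤ} (hc : c ∈ Finsupp.supported ℤ ℤ S) :
    cone e c ∈ Finsupp.supported ℤ ℤ T := by
  rw [← Finsupp.sum_single c, Finsupp.sum, map_sum]
  refine Submodule.sum_mem _ fun s hs ↦ ?_
  rw [cone_single]
  exact Finsupp.single_mem_supported ℤ _ (h s ((Finsupp.mem_supported ℤ c).1 hc hs))

/-- Since `e` comes first, removing it has sign +1, and its presence shifts every other vertex by
one place, which flips the remaining signs. -/
theorem boundary_cone_single {e : V} {s : Finset V} (hs : ∀ x ∈ s, e < x) :
    boundary (cone e (Finsupp.single s 1)) =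
      Finsupp.single s 1 - cone e (boundary (Finsupp.single s 1)) := by
  have he : e ∉ s := fun h ↦ (hs e h).false
  have h0 : (insert e s).filter (· < e) = ∅ := by
    refine Finset.filter_eq_empty_iff.2 fun x hx ↦ ?_
    rcases Finset.mem_insert.1 hx with rfl | hx
    · exact lt_irrefl _
    · exact (hs x hx).asymm
  rw [cone_single, boundary_single, boundary_single, Finset.sum_insert he, h0,
    Finset.erase_insert he, map_sum, sub_eq_add_neg, ← Finset.sum_neg_distrib]
  simp only [Finset.card_empty, pow_zero]
  congr 1
  refine Finset.sum_congr rfl fun v hv ↦ ?_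
  have hev : e < v := hs v hv
  rw [cone_single, Finset.erase_insert_of_ne hev.ne, Finset.filter_insert, if_pos hev,
    Finset.card_insert_of_notMem (by simp [he]), pow_succ, mul_neg_one, Finsupp.single_neg]

theorem boundary_cone {e : V} {c : Finset V →₀ ℤ}
    (hc : c ∈ Finsupp.supported ℤ ℤ {s : Finset V | ∀ x ∈ s, e < x}) :
    boundary (cone e c) = c - cone e (boundary c) := by
  have h : Set.EqOn (boundary ∘ₗ cone e)
      (LinearMap.id - cone e ∘ₗ boundary : (Finset V →₀ ℤ) →ₗ[ℤ] (Finset V →₀ ℤ))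
      (Finsupp.supported ℤ ℤ {s : Finset V | ∀ x ∈ s, e < x}) := by
    rw [Finsupp.supported_eq_span_single]
    refine LinearMap.eqOn_span ?_
    rintro _ ⟨s, hs, rfl⟩
    exact boundary_cone_single hs
  exact h hc

/-- A chain splits along a vertex `e` into the part avoiding `e` and a cone over a chain in the link
of `e`. -/
theorem exists_add_cone (e : V) {S : Set (Finset V)} {z : Finset V →₀ ℤ}
    (hz : z ∈ Finsupp.supported ℤ ℤ S) :
    ∃ a ∈ Finsupp.supported ℤ ℤ {s | s ∈ S ∧ e ∉ s},
      ∃ b ∈ Finsupp.supported ℤ ℤ {s | e ∉ s ∧ insert e s ∈ S}, z = a + cone e b := by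
  rw [← Finsupp.sum_single z, Finsupp.sum]
  refine Finset.sum_induction _ (fun z ↦ ∃ a ∈ Finsupp.supported ℤ ℤ {s | s ∈ S ∧ e ∉ s},
      ∃ b ∈ Finsupp.supported ℤ ℤ {s | e ∉ s ∧ insert e s ∈ S}, z = a + cone e b) ?_ ?_ ?_
  · rintro _ _ ⟨a, ha, b, hb, rfl⟩ ⟨a', ha', b', hb', rfl⟩
    exact ⟨a + a', add_mem ha ha', b + b', add_mem hb hb', by rw [map_add]; abel⟩
  · exact ⟨0, zero_mem _, 0, zero_mem _, by simp⟩
  · intro s hs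
    have hsS : s ∈ S := (Finsupp.mem_supported ℤ z).1 hz hs
    by_cases he : e ∈ s
    · refine ⟨0, zero_mem _, Finsupp.single (s.erase e) (z s),
        Finsupp.single_mem_supported ℤ _ ⟨by simp, ?_⟩, ?_⟩
      · rwa [Finset.insert_erase he]
      · rw [cone_single, Finset.insert_erase he, zero_add]
    · exact ⟨Finsupp.single s (z s), Finsupp.single_mem_supported ℤ _ ⟨hsS, he⟩, 0, zero_mem _, by simp⟩

/-- Degree -1: a multiple of the empty simplex bounds the same multiple of any vertex. The order
condition on the cone is vacuous here, so `x` need not be least. -/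
theorem exists_boundary_eq_of_mem_supported_empty {S : Set (Finset V)} {x : V} (hx : {x} ∈ S)
    {z : Finset V →₀ ℤ} (hz : z ∈ Finsupp.supported ℤ ℤ {(∅ : Finset V)}) :
    ∃ c ∈ Finsupp.supported ℤ ℤ S, boundary c = z := by
  refine ⟨cone x z, cone_mem_supported (by rintro s rfl; exact hx) hz, ?_⟩
  have h0 : boundary z ∈ Finsupp.supported ℤ ℤ (∅ : Set (Finset V)) :=
    boundary_mem_supported (by rintro s rfl v hv; simp at hv) hz
  rw [Finsupp.supported_empty, Submodule.mem_bot] at h0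
  rw [boundary_cone (Finsupp.supported_mono (by rintro s rfl; simp) hz), h0, map_zero, sub_zero]

/-- The independent sets of a matroid form a complex whose reduced homology vanishes below the top
dimension. The matroid is given by a family of finite sets satisfying the independence axioms. -/
theorem exists_boundary_eq_of_augmentation (E : Finset V) (I : Finset V → Prop)
    (hE : ∀ s, I s → s ⊆ E) (hsub : ∀ s t, s ⊆ t → I t → I s)
    (haug : ∀ s t, I s → I t → s.card < t.card → ∃ x ∈ t, x ∉ s ∧ I (insert x s))
    (k : ℕ) (B : Finset V) (hB : I B) (hBk : B.card = k + 1) (z : Finset V →₀ ℤ)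
    (hz : z ∈ Finsupp.supported ℤ ℤ {s | I s ∧ s.card = k}) (hz0 : boundary z = 0) :
    ∃ c ∈ Finsupp.supported ℤ ℤ {s | I s ∧ s.card = k + 1}, boundary c = z := by
  induction E using Finset.induction_on_min generalizing I k B z with
  | empty =>
    have := Finset.subset_empty.1 (hE B hB)
    simp [this] at hBk
  | insert e E he ih =>
    by_cases hloop : I {e}
    swap
    · refine ih I (fun s hs x hx ↦ ?_) hsub haug k B hB hBk z hz hz0
      rcases Finset.mem_insert.1 (hE s hs hx) with rfl | h
      · exact absurd (hsub _ _ (Finset.singleton_subset_iff.2 hx) hs) hloop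
      · exact h
    cases k with
    | zero =>
      refine exists_boundary_eq_of_mem_supported_empty (x := e)
        (show {e} ∈ {s | I s ∧ s.card = 0 + 1} from ⟨hloop, by simp⟩)
        (Finsupp.supported_mono ?_ hz)
      rintro s ⟨-, hs⟩
      exact Finset.card_eq_zero.1 hs
    | succ k =>
      have hlt : ∀ s, I s → e ∉ s → ∀ x ∈ s, e < x := fun s hs hes x hx ↦
        he x ((Finset.mem_insert.1 (hE s hs hx)).resolve_left (by rintro rfl; exact hes hx))
      have hE' : ∀ s, I s → e ∉ s → s ⊆ E := fun s hs hes x hx ↦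
        (Finset.mem_insert.1 (hE s hs hx)).resolve_left (by rintro rfl; exact hes hx)
      obtain ⟨a, ha, b, hb, rfl⟩ := exists_add_cone e hz
      have ha_off : a ∈ Finsupp.supported ℤ ℤ {s : Finset V | ∀ x ∈ s, e < x} :=
        Finsupp.supported_mono (fun s hs ↦ hlt s hs.1.1 hs.2) ha
      have hb_off : b ∈ Finsupp.supported ℤ ℤ {s : Finset V | ∀ x ∈ s, e < x} :=
        Finsupp.supported_mono
          (fun s hs ↦ hlt s (hsub _ _ (Finset.subset_insert _ _) hs.2.1) hs.1) hb
      rw [map_add, boundary_cone hb_off] at hz0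
      -- The cycle condition reads `∂a + b = cone e (∂b)`: no simplex on the left contains `e`,
      -- every simplex on the right does, so both sides vanish.
      have hab : boundary a + b = 0 := by
        have h1 : boundary a + b ∈ Finsupp.supported ℤ ℤ {s : Finset V | e ∉ s} := by
          refine add_mem (boundary_mem_supported ?_ ha)
            (Finsupp.supported_mono (fun s hs ↦ hs.1) hb)
          exact fun s hs v _ h ↦ hs.2 (Finset.mem_of_mem_erase h)
        have h2 : boundary a + b ∈ Finsupp.supported ℤ ℤ {s : Finset V | e ∈ s} := by
          have : boundary a + b = cone e (boundary b) := by
            rw [← sub_eq_zero, ← hz0]; abel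
          rw [this]
          exact cone_mem_supported (S := Set.univ) (by simp) (by simp)
        have h3 := Submodule.mem_inf.2 ⟨h1, h2⟩
        rw [← Finsupp.supported_inter] at h3
        have : {s : Finset V | e ∉ s} ∩ {s | e ∈ s} = ∅ := by ext; simp
        rwa [this, Finsupp.supported_empty, Submodule.mem_bot] at h3
      have hb_eq : b = -boundary a := eq_neg_of_add_eq_zero_right hab
      have hb0 : boundary b = 0 := by rw [hb_eq, map_neg, boundary_boundary, neg_zero]
      -- Does the deletion of `e` still have an independent set of the size needed to fill a cycle?
      by_cases hdel : ∃ B', I B' ∧ e ∉ B' ∧ B'.card = k + 1 + 1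
      · obtain ⟨B', hB', heB', hB'k⟩ := hdel
        have hlink : ∃ D, e ∉ D ∧ I (insert e D) ∧ D.card = k + 1 := by
          -- Grow `{e}` by augmentation from `B'`; as `e ∉ B'`, what is added to `e` stays
          -- independent in the link.
          have key : ∀ n ≤ k + 1, ∃ D, e ∉ D ∧ I (insert e D) ∧ D.card = n := by
            intro n
            induction n with
            | zero => exact fun _ ↦ ⟨∅, by simp, by simpa using hloop, rfl⟩
            | succ n ihn =>
              intro hn
              obtain ⟨D, heD, hD, hDn⟩ := ihn (by omega)
              obtain ⟨x, -, hxD, hx⟩ := haug _ B' hD hB' (by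
                rw [Finset.card_insert_of_notMem heD]; omega)
              rw [Finset.mem_insert, not_or] at hxD
              refine ⟨insert x D, ?_, by rwa [Finset.insert_comm],
                by rw [Finset.card_insert_of_notMem hxD.2, hDn]⟩
              rw [Finset.mem_insert, not_or]
              exact ⟨Ne.symm hxD.1, heD⟩
          exact key _ le_rfl
        obtain ⟨D, heD, hD, hDk⟩ := hlink
        -- Fill `b` by `c` in the link. Then `a + c` is a cycle of the deletion, filled there by
        -- `f`, and `f - cone e c` has boundary `(a + c) - (c - cone e b) = a + cone e b`.
        obtain ⟨c, hc, hcb⟩ := ih (fun s ↦ e ∉ s ∧ I (insert e s))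
          (fun s hs ↦ hE' s (hsub _ _ (Finset.subset_insert _ _) hs.2) hs.1)
          (fun s t hst ht ↦ ⟨fun h ↦ ht.1 (hst h), hsub _ _ (Finset.insert_subset_insert _ hst) ht.2⟩)
          (by
            rintro s t ⟨hes, hs⟩ ⟨het, ht⟩ hst
            obtain ⟨x, hxt, hxs, hx⟩ := haug _ _ hs ht (by
              rw [Finset.card_insert_of_notMem hes, Finset.card_insert_of_notMem het]; omega)
            rw [Finset.mem_insert, not_or] at hxs
            refine ⟨x, (Finset.mem_insert.1 hxt).resolve_left hxs.1, hxs.2, ?_,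
              by rwa [Finset.insert_comm]⟩
            rw [Finset.mem_insert, not_or]
            exact ⟨Ne.symm hxs.1, hes⟩)
          k D ⟨heD, hD⟩ hDk b
          (Finsupp.supported_mono (by
            rintro s ⟨h1, h2, h3⟩
            rw [Finset.card_insert_of_notMem h1] at h3
            exact ⟨⟨h1, h2⟩, by omega⟩) hb) hb0
        have hc_off : c ∈ Finsupp.supported ℤ ℤ {s : Finset V | ∀ x ∈ s, e < x} :=
          Finsupp.supported_mono
            (fun s hs ↦ hlt s (hsub _ _ (Finset.subset_insert _ _) hs.1.2) hs.1.1) hc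
        have ha_sub : {s | s ∈ {s | I s ∧ s.card = k + 1} ∧ e ∉ s} ⊆
            {s | (I s ∧ e ∉ s) ∧ s.card = k + 1} := fun s hs ↦ ⟨⟨hs.1.1, hs.2⟩, hs.1.2⟩
        have hc_sub : {s | (e ∉ s ∧ I (insert e s)) ∧ s.card = k + 1} ⊆
            {s | (I s ∧ e ∉ s) ∧ s.card = k + 1} := fun s hs ↦
          ⟨⟨hsub _ _ (Finset.subset_insert _ _) hs.1.2, hs.1.1⟩, hs.2⟩
        obtain ⟨f, hf, hfac⟩ := ih (fun s ↦ I s ∧ e ∉ s) (fun s hs ↦ hE' s hs.1 hs.2)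
          (fun s t hst ht ↦ ⟨hsub _ _ hst ht.1, fun h ↦ ht.2 (hst h)⟩)
          (by
            rintro s t ⟨hs, hes⟩ ⟨ht, het⟩ hst
            obtain ⟨x, hxt, hxs, hx⟩ := haug _ _ hs ht hst
            refine ⟨x, hxt, hxs, hx, ?_⟩
            rw [Finset.mem_insert, not_or]
            exact ⟨by rintro rfl; exact het hxt, hes⟩)
          (k + 1) B' ⟨hB', heB'⟩ hB'k (a + c)
          (add_mem (Finsupp.supported_mono ha_sub ha) (Finsupp.supported_mono hc_sub hc))
          (by rw [map_add, hcb, hab])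
        refine ⟨f - cone e c, sub_mem (Finsupp.supported_mono ?_ hf) (cone_mem_supported ?_ hc), ?_⟩
        · exact fun s hs ↦ ⟨hs.1.1, hs.2⟩
        · exact fun s hs ↦ ⟨hs.1.2, by rw [Finset.card_insert_of_notMem hs.1.1, hs.2]⟩
        · rw [map_sub, hfac, boundary_cone hc_off, hcb]; abel
      · push Not at hdel
        -- Every independent set of size `k + 2` contains `e`, so a face of `a` can only be
        -- augmented by `e`. The cone over `a` is thus a legal chain, and it fills the cycle because
        -- `b = -∂a`.
        refine ⟨cone e a, cone_mem_supported ?_ ha, ?_⟩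
        · rintro s ⟨⟨hs, hsk⟩, hes⟩
          obtain ⟨x, hxB, hxs, hx⟩ := haug s B hs hB (by omega)
          have hcard : (insert x s).card = k + 1 + 1 := by
            rw [Finset.card_insert_of_notMem hxs, hsk]
          obtain rfl : e = x := by
            by_contra hne
            exact hdel _ hx (by simp [hne, hes]) hcard
          exact ⟨hx, hcard⟩
        · rw [boundary_cone ha_off, hb_eq, map_neg]; abel

/-! ### Ranks of cycle groups. -/

theorem finite_supported {ι : Type*} {S : Set ι} (hS : S.Finite) :
    Module.Finite ℤ (Finsupp.supported ℤ ℤ S) := by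
  have := hS.fintype
  exact Module.Finite.equiv (Finsupp.supportedEquivFinsupp (M := ℤ) (R := ℤ) S).symm

theorem finrank_supported {ι : Type*} {S : Set ι} (hS : S.Finite) :
    Module.finrank ℤ (Finsupp.supported ℤ ℤ S) = S.ncard := by
  have := hS.fintype
  rw [(Finsupp.supportedEquivFinsupp (M := ℤ) (R := ℤ) S).finrank_eq,
    Module.finrank_finsupp_self, ← Nat.card_eq_fintype_card, Nat.card_coe_set_eq]

theorem finrank_map_add_finrank_inf_ker {M N : Type*} [AddCommGroup M] [AddCommGroup N]
    (C : Submodule ℤ M) [Module.Finite ℤ C] (f : M →ₗ[ℤ] N) :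
    Module.finrank ℤ (C.map f) + Module.finrank ℤ (C ⊓ LinearMap.ker f : Submodule ℤ M) =
      Module.finrank ℤ C := by
  have h := (LinearMap.ker (f.domRestrict C)).finrank_quotient_add_finrank
  rw [LinearEquiv.finrank_eq (f.domRestrict C).quotKerEquivRange, LinearMap.range_domRestrict,
    LinearMap.ker_domRestrict] at h
  rw [← h, ← Submodule.map_comap_subtype C (LinearMap.ker f),
    (Submodule.equivMapOfInjective _ C.subtype_injective _).finrank_eq]

/-- The rank of the top cycles of the complex of independent sets of a matroid. -/
theorem finrank_cycles_of_augmentation (E : Finset V) (I : Finset V → Prop) [DecidablePred I]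
    (hE : ∀ s, I s → s ⊆ E) (hsub : ∀ s t, s ⊆ t → I t → I s)
    (haug : ∀ s t, I s → I t → s.card < t.card → ∃ x ∈ t, x ∉ s ∧ I (insert x s))
    (B : Finset V) (hB : I B) :
    (Module.finrank ℤ (Finsupp.supported ℤ ℤ {s | I s ∧ s.card = B.card} ⊓
      LinearMap.ker boundary : Submodule ℤ (Finset V →₀ ℤ)) : ℤ) =
      ∑ s ∈ E.powerset with I s ∧ s.card ≤ B.card, (-1) ^ (B.card + s.card) := by
  have hfin : ∀ k, {s | I s ∧ s.card = k}.Finite := fun k ↦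
    E.powerset.finite_toSet.subset fun s hs ↦ by simpa using hE s hs.1
  have hncard : ∀ k, {s | I s ∧ s.card = k}.ncard =
      (E.powerset.filter fun s ↦ I s ∧ s.card = k).card := fun k ↦ by
    rw [← Set.ncard_coe_finset]
    congr 1
    ext s
    simpa using fun h _ ↦ hE s h
  -- Here `k` counts vertices, so the dimension is `k - 1`. Exactness below the top gives `rank
  -- Z_(k+1) = rank C_(k+1) - rank Z_k`, which unwinds to the alternating sum.
  suffices key : ∀ k ≤ B.card, (Module.finrank ℤ (Finsupp.supported ℤ ℤ {s | I s ∧ s.card = k} ⊓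
      LinearMap.ker boundary : Submodule ℤ (Finset V →₀ ℤ)) : ℤ) =
      ∑ s ∈ E.powerset with I s ∧ s.card ≤ k, (-1) ^ (k + s.card) from key _ le_rfl
  intro k
  induction k with
  | zero =>
    intro _
    have hle : Finsupp.supported ℤ ℤ {s | I s ∧ s.card = 0} ≤
        LinearMap.ker (boundary (V := V)) := by
      intro c hc
      have h0 : boundary c ∈ Finsupp.supported ℤ ℤ (∅ : Set (Finset V)) := by
        refine boundary_mem_supported ?_ hc
        rintro s ⟨-, hs⟩ v hv
        simp [Finset.card_eq_zero.1 hs] at hv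
      simpa using h0
    rw [inf_eq_left.2 hle, finrank_supported (hfin 0), hncard, Finset.card_eq_sum_ones,
      Nat.cast_sum]
    refine Finset.sum_congr (by simp) fun s hs ↦ ?_
    simp only [Finset.mem_filter, nonpos_iff_eq_zero] at hs
    simp [hs.2.2]
  | succ k ih =>
    intro hk
    have := finite_supported (hfin (k + 1))
    have hrank := finrank_map_add_finrank_inf_ker
      (Finsupp.supported ℤ ℤ {s | I s ∧ s.card = k + 1}) (boundary (V := V))
    have hexact : (Finsupp.supported ℤ ℤ {s | I s ∧ s.card = k + 1}).map (boundary (V := V)) =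
        Finsupp.supported ℤ ℤ {s | I s ∧ s.card = k} ⊓ LinearMap.ker boundary := by
      refine le_antisymm ?_ ?_
      · rintro _ ⟨c, hc, rfl⟩
        refine ⟨boundary_mem_supported ?_ hc, boundary_boundary c⟩
        rintro s ⟨hs, hsk⟩ v hv
        exact ⟨hsub _ _ (Finset.erase_subset _ _) hs, by rw [Finset.card_erase_of_mem hv]; omega⟩
      · rintro z ⟨hz, hz0⟩
        obtain ⟨B', hB', hcard⟩ := Finset.exists_subset_card_eq hk
        exact exists_boundary_eq_of_augmentation E I hE hsub haug k B' (hsub _ _ hB' hB) hcard z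
          hz hz0
    rw [hexact, finrank_supported (hfin _), hncard] at hrank
    have hsplit : (E.powerset.filter fun s ↦ I s ∧ s.card ≤ k + 1) =
        (E.powerset.filter fun s ↦ I s ∧ s.card ≤ k) ∪
          E.powerset.filter fun s ↦ I s ∧ s.card = k + 1 := by
      ext s
      simp only [Finset.mem_filter, Finset.mem_union, Nat.le_succ_iff, Nat.succ_eq_add_one]
      tauto
    have hdisj : Disjoint (E.powerset.filter fun s ↦ I s ∧ s.card ≤ k)
        (E.powerset.filter fun s ↦ I s ∧ s.card = k + 1) := by
      rw [Finset.disjoint_filter]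
      omega
    have htop : ∑ s ∈ E.powerset with I s ∧ s.card = k + 1, (-1 : ℤ) ^ (k + 1 + s.card) =
        (E.powerset.filter fun s ↦ I s ∧ s.card = k + 1).card := by
      rw [Finset.card_eq_sum_ones, Nat.cast_sum]
      refine Finset.sum_congr rfl fun s hs ↦ ?_
      rw [(Finset.mem_filter.1 hs).2.2, Even.neg_one_pow ⟨_, rfl⟩, Nat.cast_one]
    have hlow : ∑ s ∈ E.powerset with I s ∧ s.card ≤ k, (-1 : ℤ) ^ (k + 1 + s.card) =
        -∑ s ∈ E.powerset with I s ∧ s.card ≤ k, (-1 : ℤ) ^ (k + s.card) := by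
      rw [← Finset.sum_neg_distrib]
      exact Finset.sum_congr rfl fun s _ ↦ by ring
    rw [hsplit, Finset.sum_union hdisj, htop, hlow, ← ih (by omega), ← hrank]
    push_cast
    ring

end PreAbstractSimplicialComplex
end

/-! ### The Möbius function and Whitney's expansion. -/

noncomputable section

namespace Matroid

variable {α : Type*}

open Classical in
/-- The Möbius function of the lattice of flats of a loopless matroid, as a signed count of spanning
subsets of a flat. -/
theorem mu_flat_eq_sum (M : Matroid α) [M.Finite] [M.Loopless] (F : M.Flat) :
    IncidenceAlgebra.mu ℤ (⟨M.closure ∅, M.isFlat_closure ∅⟩ : M.Flat) F =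
      ∑ A ∈ M.ground_finite.toFinset.powerset with
        (⟨M.closure (A : Finset α), M.isFlat_closure A⟩ : M.Flat) = F, (-1 : ℤ) ^ A.card := by
  set E := M.ground_finite.toFinset with hE
  set z : M.Flat := ⟨M.closure ∅, M.isFlat_closure ∅⟩ with hz
  let cl : Finset α → M.Flat := fun A ↦ ⟨M.closure A, M.isFlat_closure A⟩
  let g : M.Flat → ℤ := fun F ↦ ∑ A ∈ E.powerset with cl A = F, (-1 : ℤ) ^ A.card
  change IncidenceAlgebra.mu ℤ z F = g F
  have hcl : ∀ (A : Set α) (G : M.Flat), A ⊆ G → M.closure A ⊆ G := fun A G h ↦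
    (M.closure_subset_closure h).trans G.2.closure.subset
  have hzle : ∀ G : M.Flat, z ≤ G := fun G ↦ hcl ∅ G (Set.empty_subset _)
  have hz0 : (z : Set α) = ∅ := M.loops_eq_empty
  -- The defining recursion of `μ`, checked for `g`: grouping the subsets of `G` by closure turns
  -- the sum into `∑_{A ⊆ G} (-1)^|A|`, which is 1 for `G = ∅` and 0 otherwise. Looplessness
  -- identifies `∅` with the least flat.
  have hsum : ∀ G : M.Flat, ∑ H ∈ Finset.Icc z G, g H = if z = G then 1 else 0 := by
    intro G
    have hGE : (G : Set α) ⊆ M.E := G.2.subset_ground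
    have hGfin := M.ground_finite.subset hGE
    have hIcc : ∑ H ∈ Finset.Icc z G, g H = ∑ A ∈ hGfin.toFinset.powerset, (-1 : ℤ) ^ A.card := by
      rw [← Finset.sum_fiberwise_of_maps_to (s := hGfin.toFinset.powerset)
        (t := Finset.Icc z G) (g := cl)]
      · refine Finset.sum_congr rfl fun H hH ↦ Finset.sum_congr ?_ fun _ _ ↦ rfl
        ext A
        simp only [Finset.mem_filter, Finset.mem_powerset, hE, Set.Finite.subset_toFinset]
        refine and_congr_left fun hA ↦ ⟨fun h ↦ ?_, fun h ↦ h.trans hGE⟩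
        have h1 : (A : Set α) ⊆ M.closure A := M.subset_closure A h
        have h2 : M.closure A = H := congrArg Subtype.val hA
        exact (h2 ▸ h1).trans (Finset.mem_Icc.1 hH).2
      · intro A hA
        rw [Finset.mem_powerset, Set.Finite.subset_toFinset] at hA
        exact Finset.mem_Icc.2 ⟨hzle _, hcl A G hA⟩
    rw [hIcc, Finset.sum_powerset_neg_one_pow_card]
    refine if_congr ?_ rfl rfl
    rw [Set.Finite.toFinset_eq_empty, Subtype.ext_iff, hz0, eq_comm]
  induction F using WellFoundedLT.induction with
  | ind F ih =>
    have h1 := hsum F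
    rw [← IncidenceAlgebra.sum_Icc_mu_right z F, ← Finset.Ico_insert_right (hzle F),
      Finset.sum_insert (by simp), Finset.sum_insert (by simp),
      Finset.sum_congr rfl fun G hG ↦ ih G (Finset.mem_Ico.1 hG).2] at h1
    exact (add_right_cancel h1).symm

/-- Whitney's expansion of the characteristic polynomial of a loopless matroid. -/
theorem characteristicPolynomial_eq_sum_powerset (M : Matroid α) [M.Finite] [M.Loopless] :
    M.characteristicPolynomial = ∑ A ∈ M.ground_finite.toFinset.powerset,
      Polynomial.C ((-1 : ℤ) ^ A.card) * Polynomial.X ^ (M.eRank - M.eRk A).toNat := by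
  classical
  rw [characteristicPolynomial, ← Finset.sum_fiberwise M.ground_finite.toFinset.powerset
    (fun A : Finset α ↦ (⟨M.closure A, M.isFlat_closure A⟩ : M.Flat))
    (fun A ↦ Polynomial.C ((-1 : ℤ) ^ A.card) * Polynomial.X ^ (M.eRank - M.eRk A).toNat)]
  refine Finset.sum_congr rfl fun F _ ↦ ?_
  rw [mu_flat_eq_sum, map_sum, Finset.sum_mul]
  refine Finset.sum_congr (by congr!) fun A hA ↦ ?_
  rw [← (Finset.mem_filter.1 hA).2, eRk_closure_eq]

/-! ### Truncations and their duals. -/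

theorem truncation_indep_iff {M : Matroid α} [M.Finite] {i : ℕ} {I : Set α} :
    (M.truncation i).Indep I ↔ M.Indep I ∧ I.encard ≤ M.eRank - (i : ℕ∞) := by
  simp [truncation]

theorem truncation_ground {M : Matroid α} [M.Finite] {i : ℕ} : (M.truncation i).E = M.E := rfl

instance (M : Matroid α) [M.Finite] (i : ℕ) : (M.truncation i).Finite :=
  ⟨M.ground_finite⟩

/-- An independent set of the maximal allowed size is a base. A base of `M` contains a subset of
that size, and all bases are equicardinal. Subtraction in `ℕ∞` is truncated, so no bound on `i` is
needed. -/
theorem truncation_isBase_iff {M : Matroid α} [M.Finite] {i : ℕ} {B : Set α} :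
    (M.truncation i).IsBase B ↔ M.Indep B ∧ B.encard = M.eRank - (i : ℕ∞) := by
  have aux : ∀ B, M.Indep B → B.encard = M.eRank - (i : ℕ∞) → (M.truncation i).IsBase B := by
    intro B hB hcard
    have hBi : (M.truncation i).Indep B := truncation_indep_iff.2 ⟨hB, hcard.le⟩
    refine hBi.isBase_of_maximal fun J hJ hBJ ↦ ?_
    have hJ' := truncation_indep_iff.1 hJ
    exact (M.ground_finite.subset hB.subset_ground).eq_of_subset_of_encard_le hBJ
      (hJ'.2.trans hcard.ge)
  refine ⟨fun h ↦ ⟨(truncation_indep_iff.1 h.indep).1, ?_⟩, fun h ↦ aux B h.1 h.2⟩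
  obtain ⟨B₀, hB₀⟩ := M.exists_isBase
  obtain ⟨B₁, hB₁, hcard⟩ := Set.exists_subset_encard_eq
    (show M.eRank - (i : ℕ∞) ≤ B₀.encard by rw [hB₀.encard_eq_eRank]; exact tsub_le_self)
  rw [h.encard_eq_encard_of_isBase (aux B₁ (hB₀.indep.subset hB₁) hcard), hcard]

/-- Independence in the dual means that the complement contains a base of the truncation, that is,
an independent set of `M` of the prescribed size. -/
theorem truncation_dual_indep_iff {M : Matroid α} [M.Finite] {i : ℕ} {I : Set α} :
    (M.truncation i)✶.Indep I ↔ I ⊆ M.E ∧ M.eRank - (i : ℕ∞) ≤ M.eRk (M.E \ I) := by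
  rw [dual_indep_iff_exists', truncation_ground, le_eRk_iff]
  refine and_congr_right fun _ ↦ ⟨?_, ?_⟩
  · rintro ⟨B, hB, hIB⟩
    rw [truncation_isBase_iff] at hB
    exact ⟨B, Set.subset_sdiff.2 ⟨hB.1.subset_ground, hIB.symm⟩, hB⟩
  · rintro ⟨B, hBI, hB⟩
    exact ⟨B, truncation_isBase_iff.2 hB, (Set.subset_sdiff.1 hBI).2.symm⟩

theorem eRank_truncation {M : Matroid α} [M.Finite] {i : ℕ} :
    (M.truncation i).eRank = M.eRank - (i : ℕ∞) := by
  obtain ⟨B, hB⟩ := (M.truncation i).exists_isBase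
  rw [← hB.encard_eq_eRank, (truncation_isBase_iff.1 hB).2]

/-! ### Top homology as an alternating count. -/

open Classical in
/-- The rank of the top reduced homology of the independence complex of a matroid is, up to sign,
its reduced Euler characteristic. -/
theorem finrank_reducedHomology_independenceComplex [LinearOrder α] (N : Matroid α) [N.Finite]
    (r : ℕ) (hr : N.eRank = r) (j : ℤ) (hj : j + 1 = r) :
    (Module.finrank ℤ (N.independenceComplex.ReducedHomology j) : ℤ) =
      ∑ s ∈ N.ground_finite.toFinset.powerset with N.Indep ((s : Finset α) : Set α),
        (-1) ^ (r + s.card) := by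
  have hcard : ∀ s : Finset α, N.Indep (s : Set α) → s.card ≤ r := fun s hs ↦ by
    have := hs.encard_le_eRank
    rw [hr, Set.encard_coe_eq_coe_finsetCard] at this
    exact_mod_cast this
  have hface : ∀ s : Finset α, (s = ∅ ∨ s ∈ N.independenceComplex) ↔ N.Indep (s : Set α) := by
    intro s
    change (s = ∅ ∨ s.Nonempty ∧ N.Indep (s : Set α)) ↔ _
    rcases s.eq_empty_or_nonempty with rfl | hs
    · simp
    · simp [hs, hs.ne_empty]
  -- No face has more than `r` elements, so in the top dimension homology is just the group of
  -- cycles.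
  have hbd : N.independenceComplex.boundaries j = ⊥ := by
    have : {s : Finset α | (s = ∅ ∨ s ∈ N.independenceComplex) ∧ (s.card : ℤ) = j + 1 + 1} = ∅ := by
      ext s
      simp only [hface, Set.mem_ofPred_eq, Set.mem_empty_iff_false, iff_false, not_and]
      intro hs
      have := hcard s hs
      omega
    rw [PreAbstractSimplicialComplex.boundaries, PreAbstractSimplicialComplex.chains, this,
      Finsupp.supported_empty, Submodule.map_bot]
  have hcyc : N.independenceComplex.cycles j =
      Finsupp.supported ℤ ℤ {s : Finset α | N.Indep (s : Set α) ∧ s.card = r} ⊓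
        LinearMap.ker PreAbstractSimplicialComplex.boundary := by
    rw [PreAbstractSimplicialComplex.cycles, PreAbstractSimplicialComplex.chains]
    simp only [hface, hj, Nat.cast_inj]
  have hbot : (N.independenceComplex.boundaries j).submoduleOf (N.independenceComplex.cycles j) =
      ⊥ := by
    rw [hbd, Submodule.submoduleOf, Submodule.comap_bot, Submodule.ker_subtype]
  rw [(Submodule.quotEquivOfEqBot _ hbot).finrank_eq, hcyc]
  obtain ⟨B, hB⟩ := N.exists_isBase
  have hBfin := N.ground_finite.subset hB.subset_ground
  have hBr : hBfin.toFinset.card = r := by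
    have := hB.encard_eq_eRank
    rw [hr, hBfin.encard_eq_coe_toFinset_card] at this
    exact_mod_cast this
  have key := PreAbstractSimplicialComplex.finrank_cycles_of_augmentation N.ground_finite.toFinset
    (fun s ↦ N.Indep (s : Set α))
    (fun s hs ↦ by simpa using hs.subset_ground)
    (fun s t hst ht ↦ ht.subset (Finset.coe_subset.2 hst))
    (fun s t hs ht hst ↦ by
      obtain ⟨x, hx, hxs⟩ := hs.augment ht (by
        rw [Set.encard_coe_eq_coe_finsetCard, Set.encard_coe_eq_coe_finsetCard]
        exact_mod_cast hst)
      exact ⟨x, hx.1, hx.2, by simpa using hxs⟩)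
    hBfin.toFinset (by simpa using hB.indep)
  rw [hBr] at key
  rw [key]
  refine Finset.sum_congr (Finset.filter_congr fun s _ ↦ ?_) fun _ _ ↦ rfl
  exact and_iff_left_of_imp (hcard s)

-- The degree is the top dimension of the dual, whose rank is `m - (d - i)`. Complementation in `E`
-- carries its independent sets to the sets of rank at least `d - i`.
open Classical in
theorem finrank_reducedHomology_truncation_dual [LinearOrder α] (M : Matroid α) [M.Finite]
    (d m i : ℕ) (hd : M.eRank = d) (hm : M.E.encard = m) :
    (Module.finrank ℤ ((M.truncation i)✶.independenceComplex.ReducedHomology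
      ((m : ℤ) - (d - i : ℕ) - 1)) : ℤ) =
      ∑ A ∈ M.ground_finite.toFinset.powerset with d - i ≤ (M.eRk ((A : Finset α) : Set α)).toNat,
        (-1) ^ (d - i + A.card) := by
  set E := M.ground_finite.toFinset with hE
  have hEm : E.card = m := by
    rw [M.ground_finite.encard_eq_coe_toFinset_card] at hm
    exact_mod_cast hm
  have hdi : M.eRank - (i : ℕ∞) = (d - i : ℕ) := by rw [hd, ENat.natCast_sub]
  have hsum := (M.truncation i).eRank_add_eRank_dual
  rw [eRank_truncation, hdi, truncation_ground, hm] at hsum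
  obtain ⟨r, hr⟩ : ∃ r : ℕ, (M.truncation i)✶.eRank = r :=
    ENat.ne_top_iff_exists.1 (fun h ↦ by simp [h] at hsum) |>.imp fun _ h ↦ h.symm
  rw [hr] at hsum
  have hsum' : d - i + r = m := by exact_mod_cast hsum
  rw [finrank_reducedHomology_independenceComplex _ r hr _ (by omega)]
  have hmem : ∀ A : Finset α, (d - i ≤ (M.eRk (A : Set α)).toNat) ↔
      M.eRank - (i : ℕ∞) ≤ M.eRk (A : Set α) := by
    intro A
    have hne : M.eRk (A : Set α) ≠ ⊤ := (M.isRkFinite_set _).eRk_lt_top.ne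
    rw [hdi, ← ENat.natCast_toNat hne, Nat.cast_le, ENat.toNat_natCast]
  have hcoe : (E : Set α) = M.E := by simp [hE]
  refine Finset.sum_nbij' (fun s ↦ E \ s) (fun A ↦ E \ A) ?_ ?_ ?_ ?_ ?_
  · intro s hs
    have hs' := (Finset.mem_filter.1 hs).2
    rw [truncation_dual_indep_iff] at hs'
    rw [Finset.mem_filter, hmem, Finset.coe_sdiff, hcoe]
    exact ⟨by simp, hs'.2⟩
  · intro A hA
    rw [Finset.mem_filter, hmem, Finset.mem_powerset] at hA
    rw [Finset.mem_filter, truncation_dual_indep_iff, ← hcoe, ← Finset.coe_sdiff,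
      Finset.sdiff_sdiff_eq_self hA.1]
    refine ⟨?_, Finset.coe_subset.2 Finset.sdiff_subset, hA.2⟩
    rw [Finset.mem_powerset]
    exact Finset.sdiff_subset
  · intro s hs
    exact Finset.sdiff_sdiff_eq_self (Finset.mem_powerset.1 (Finset.mem_filter.1 hs).1)
  · intro A hA
    exact Finset.sdiff_sdiff_eq_self (Finset.mem_powerset.1 (Finset.mem_filter.1 hA).1)
  · intro s hs
    have hsE : s ⊆ E := Finset.mem_powerset.1 (Finset.mem_filter.1 hs).1
    have h1 : (E \ s).card + s.card = m := by rw [Finset.card_sdiff_add_card_eq_card hsE, hEm]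
    -- The two exponents have an even sum, so the signs agree.
    have h2 : d - i + (E \ s).card + (r + s.card) = 2 * m := by omega
    have h3 : (-1 : ℤ) ^ (d - i + (E \ s).card) * (-1) ^ (r + s.card) = 1 := by
      rw [← pow_add, h2, Even.neg_one_pow (by simp)]
    rcases neg_one_pow_eq_or ℤ (r + s.card) with h | h <;> rw [h] at h3 ⊢ <;> linarith

end Matroid
end

/-! ### Assembly by geometric sums. -/

theorem corollary3p2 {α : Type*} [LinearOrder α] (M : Matroid α) [M.Finite] [M.Loopless]
    (d m : ℕ) (hd : M.eRank = d) (hd1 : 1 ≤ d) (hm : M.E.encard = m) :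
    M.characteristicPolynomial =
      (-1) ^ d * (1 - Polynomial.X) *
        ∑ i ∈ Finset.range d,
          Polynomial.C
              (Module.finrank ℤ
                ((M.truncation i)✶.independenceComplex.ReducedHomology
                  ((m : ℤ) - d + i - 1)) : ℤ) *
            (-Polynomial.X) ^ i := by
  classical
  set E := M.ground_finite.toFinset with hE
  have hrk : ∀ A : Finset α, ∃ k : ℕ, k ≤ d ∧ M.eRk (A : Set α) = k := fun A ↦ by
    have hle := hd ▸ M.eRk_le_eRank (A : Set α)
    obtain ⟨k, hk⟩ := ENat.ne_top_iff_exists.1 (ne_top_of_le_ne_top (ENat.natCast_ne_top d) hle)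
    exact ⟨k, by rw [← hk] at hle; exact_mod_cast hle, hk.symm⟩
  -- Positive rank makes `E` nonempty, which is what kills `∑_A (-1)^|A|` in `hzero`.
  have hEne : E.Nonempty := by
    obtain ⟨B, hB⟩ := M.exists_isBase
    have hBne : B.Nonempty := by
      rw [Set.nonempty_iff_ne_empty]
      rintro rfl
      have := hB.encard_eq_eRank
      rw [hd, Set.encard_empty] at this
      have : 0 = d := by exact_mod_cast this
      omega
    simpa [hE] using hBne.mono hB.subset_ground
  have hterm : ∀ i ∈ Finset.range d, Polynomial.C
      (Module.finrank ℤ ((M.truncation i)✶.independenceComplex.ReducedHomology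
        ((m : ℤ) - d + i - 1)) : ℤ) * (-Polynomial.X) ^ i =
      (-1) ^ d * ∑ A ∈ E.powerset, Polynomial.C ((-1 : ℤ) ^ A.card) *
        if d - (M.eRk (A : Set α)).toNat ≤ i then Polynomial.X ^ i else 0 := by
    intro i hi
    have hid : i < d := Finset.mem_range.1 hi
    -- The natural subtraction is exact because `i < d`.
    have hj : (m : ℤ) - d + i - 1 = (m : ℤ) - (d - i : ℕ) - 1 := by omega
    have hsign : (-1 : Polynomial ℤ) ^ (d - i) * (-1) ^ i = (-1) ^ d := by
      rw [← pow_add, Nat.sub_add_cancel hid.le]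
    rw [hj, M.finrank_reducedHomology_truncation_dual d m i hd hm, Finset.sum_filter, map_sum,
      Finset.sum_mul, Finset.mul_sum]
    refine Finset.sum_congr rfl fun A _ ↦ ?_
    by_cases h : d - i ≤ (M.eRk (A : Set α)).toNat
    · rw [if_pos h, if_pos (by omega), neg_pow (Polynomial.X : Polynomial ℤ) i, ← hsign, pow_add]
      simp only [map_mul, map_pow, map_neg, map_one]
      ring
    · rw [if_neg h, if_neg (by omega)]
      simp
  have hgeom : ∀ k ≤ d, (1 - Polynomial.X : Polynomial ℤ) *
      ∑ i ∈ Finset.range d, (if d - k ≤ i then Polynomial.X ^ i else 0) =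
      Polynomial.X ^ (d - k) - Polynomial.X ^ d := by
    intro k _
    rw [← Finset.sum_filter]
    have : (Finset.range d).filter (d - k ≤ ·) = Finset.Ico (d - k) d := by
      ext i
      simp [and_comm]
    rw [this, mul_comm, geom_sum_Ico_mul_neg _ (Nat.sub_le d k)]
  have hzero : ∑ A ∈ E.powerset, Polynomial.C ((-1 : ℤ) ^ A.card) = 0 := by
    rw [← map_sum, Finset.sum_powerset_neg_one_pow_card_of_nonempty hEne, map_zero]
  have hsq : (-1 : Polynomial ℤ) ^ d * (-1) ^ d = 1 := by
    rw [← mul_pow]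
    simp
  rw [Finset.sum_congr rfl hterm, ← Finset.mul_sum, Finset.sum_comm,
    M.characteristicPolynomial_eq_sum_powerset]
  -- Subtracting `X ^ d` from every term costs nothing by `hzero` and gives each term the shape of
  -- `hgeom`.
  calc _ = ∑ A ∈ E.powerset, Polynomial.C ((-1 : ℤ) ^ A.card) *
        (Polynomial.X ^ (d - (M.eRk (A : Set α)).toNat) - Polynomial.X ^ d) := by
        simp only [mul_sub, Finset.sum_sub_distrib]
        rw [← Finset.sum_mul, hzero, zero_mul, sub_zero]
        refine Finset.sum_congr rfl fun A _ ↦ ?_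
        obtain ⟨k, hk, hAk⟩ := hrk A
        rw [hd, hAk, ← ENat.natCast_sub, ENat.toNat_natCast, ENat.toNat_natCast]
    _ = ((-1) ^ d * (-1) ^ d) * ((1 - Polynomial.X) * ∑ A ∈ E.powerset,
        ∑ i ∈ Finset.range d, Polynomial.C ((-1 : ℤ) ^ A.card) *
          if d - (M.eRk (A : Set α)).toNat ≤ i then Polynomial.X ^ i else 0) := by
        rw [hsq, one_mul, Finset.mul_sum]
        refine Finset.sum_congr rfl fun A _ ↦ ?_
        obtain ⟨k, hk, hAk⟩ := hrk A
        rw [hAk, ENat.toNat_natCast, ← hgeom k hk, ← Finset.mul_sum]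
        ring
    _ = _ := by ring
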